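/- Let $R$ be a commutative noetherian domain of Krull dimension $1$ and let $\alpha$ be a ring automorphism of $R$. Assume that $R$ is $\alpha$-special: there is an element $a\in R$ such that for every non-zero ideal $I$ of $R$ with $\alpha(I)=I$ there is an integer $n\ge 1$ with $0\neq a\,\alpha(a)\cdots\alpha^{n-1}(a)\in I$. Let $S=R[\theta;\alpha]$ be the skew polynomial ring in which $\theta r=\alpha(r)\theta$ for all $r\in R$. (i) The action of $\alpha$ on $\mathrm{Spec}(R)$ (by $P\mapsto\alpha(P)$) has only finitely many finite orbits. In particular, if every $\alpha$-orbit in $\mathrm{Spec}(R)$ is finite, then $\mathrm{Spec}(R)$ is finite. (ii) If $R$ contains an uncountable field as a subring and $\mathrm{Spec}(R)$ is infinite, then $S$ does not satisfy $(\diamond)$. Here a ring $A$ satisfies $(\diamond)$ if, for every simple right $A$-module $V$, every finitely generated submodule of the injective hull of $V$ has finite composition length. -/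

import Mathlib

universe u v

/-! ### Skew polynomial rings -/

/-- The action of the monoid `ℕ` (written multiplicatively) on `R` in which `n` acts by the power
`α ^ n` of the automorphism `α`. -/
@[reducible] def autPowAction {R : Type u} [CommRing R] (α : R ≃+* R) :
    MulSemiringAction (Multiplicative ℕ) R :=
  MulSemiringAction.compHom R (powersHom (RingAut R) α)

/-- The skew polynomial ring `R[θ; α]`: polynomials `∑ rₙ θⁿ` with coefficients in `R`,
multiplied by the rule `θ r = α(r) θ`. It is Mathlib's `SkewPolynomial R`, for the action of `ℕ`
on `R` by the powers of `α`; it is a type of its own, so that its ring structure depends on `α`. -/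
def SkewPolynomialRing (R : Type u) [CommRing R] (_α : R ≃+* R) : Type u :=
  SkewPolynomial R

noncomputable instance SkewPolynomialRing.instRing (R : Type u) [CommRing R] (α : R ≃+* R) :
    Ring (SkewPolynomialRing R α) :=
  letI : MulSemiringAction (Multiplicative ℕ) R := autPowAction α
  inferInstanceAs (Ring (SkewMonoidAlgebra R (Multiplicative ℕ)))

/-! ### Injective hulls and property (⋄) -/

/-- `i : V → E` is an injective hull of the `A`-module `V`: the module `E` is injective and `i`
embeds `V` as an essential submodule of `E`. -/
structure IsInjectiveHull (A : Type u) [Ring A] {V E : Type v} [AddCommGroup V] [Module A V]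
    [AddCommGroup E] [Module A E] (i : V →ₗ[A] E) : Prop where
  injective_module : Module.Injective A E
  injective_map : Function.Injective i
  essential : ∀ N : Submodule A E, N ⊓ LinearMap.range i = ⊥ → N = ⊥

/-- The `A`-module `V` satisfies (⋄): every finitely generated submodule of the injective hull of
`V` has finite composition length. -/
def ModuleSatisfiesDiamond (A : Type u) [Ring A] (V : Type u) [AddCommGroup V] [Module A V] :
    Prop :=
  ∀ (E : Type u) [AddCommGroup E] [Module A E] (i : V →ₗ[A] E), IsInjectiveHull A i →
    ∀ N : Submodule A E, N.FG → IsFiniteLength A N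

/-- The ring `A` satisfies (right) (⋄): every simple right `A`-module satisfies (⋄). Right
`A`-modules are modules over the opposite ring. -/
def SatisfiesDiamond (A : Type u) [Ring A] : Prop :=
  ∀ (V : Type u) [AddCommGroup V] [Module Aᵐᵒᵖ V], IsSimpleModule Aᵐᵒᵖ V →
    ModuleSatisfiesDiamond Aᵐᵒᵖ V

/-! ### Special elements and orbits -/

/-- `a` is an `α`-special element of `R`: for every nonzero `α`-invariant ideal `I` there is
`n ≥ 1` with `0 ≠ a α(a) ⋯ α^(n-1)(a) ∈ I`. -/
def IsSpecialElement {R : Type u} [CommRing R] (α : R ≃+* R) (a : R) : Prop :=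
  ∀ I : Ideal R, I ≠ ⊥ → I.map (α : R →+* R) = I →
    ∃ n : ℕ, 1 ≤ n ∧ ∏ j ∈ Finset.range n, (α ^ j) a ≠ 0 ∧ ∏ j ∈ Finset.range n, (α ^ j) a ∈ I

/-- The ring `R` is `α`-special: it has an `α`-special element. -/
def IsSpecialRing (R : Type u) [CommRing R] (α : R ≃+* R) : Prop :=
  ∃ a : R, IsSpecialElement α a

/-- The `α`-orbit `{αⁿ(P) : n ∈ ℤ}` of `P ∈ Spec R`; the ideal `αⁿ(P)` is the preimage of `P`
under `α⁻ⁿ`. -/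
def specOrbit {R : Type u} [CommRing R] (α : R ≃+* R) (P : PrimeSpectrum R) :
    Set (PrimeSpectrum R) :=
  Set.range fun n : ℤ => PrimeSpectrum.comap ((α ^ (-n) : R ≃+* R) : R →+* R) P

/-! ### Orbits of prime ideals -/

section Orbits

variable {R : Type u} [CommRing R]

/-! For (i): the intersection of a finite orbit of nonzero primes is a nonzero `α`-invariant ideal,
so it contains some product `a α(a) ⋯`, and hence `a` lies in a prime of that orbit. Since `a ≠ 0`
and the dimension is one, only finitely many primes contain `a`.

For (ii): by (i) some `P` has an infinite orbit. Let `J` be the intersection of the nonzero primes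
with finite orbit. Every nonzero element of `J` is special (`finiteOrbitIdeal_le_radical`), and `J`
lies in no prime of the orbit of `P`; countable prime avoidance yields a special `a` outside all of
these primes. Let `θ` act on the fraction field by `x ↦ a⁻¹ α⁻¹(x)`. Specialness puts `1` in every
nonzero submodule (`one_mem_of_ne_bot`), so `1` generates an essential simple submodule `V`, and the
fraction field embeds in a hull of `V`. Choose `m` with annihilator `P` modulo `R`. Then `θᵏ` moves
the pole of `m` to `α⁻ᵏ(P)`; these primes are distinct, so the submodules generated by the `θᵏ m`
descend strictly and `m` generates a module of infinite length. -/

theorem Ideal.map_eq_self_of_forall_mem_iff {α : R ≃+* R} {I : Ideal R}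
    (h : ∀ r, α r ∈ I ↔ r ∈ I) : I.map (α : R →+* R) = I := by
  refine le_antisymm (Ideal.map_le_iff_le_comap.mpr fun r hr => (h r).mpr hr) fun r hr => ?_
  have h1 : α.symm r ∈ I := (h _).mp (by simpa using hr)
  simpa using Ideal.mem_map_of_mem (α : R →+* R) h1

theorem Ideal.forall_mem_iff_of_map_eq_self {α : R ≃+* R} {I : Ideal R}
    (h : I.map (α : R →+* R) = I) (r : R) : α r ∈ I ↔ r ∈ I := by
  constructor
  · intro hr
    rw [← h] at hr
    obtain ⟨s, hs, hsr⟩ := (Ideal.mem_map_of_equiv α (α r)).mp hr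
    rwa [← α.injective hsr]
  · intro hr
    rw [← h]
    exact Ideal.mem_map_of_mem _ hr

theorem Ideal.zpow_apply_mem_iff {α : R ≃+* R} {I : Ideal R}
    (h : ∀ r, α r ∈ I ↔ r ∈ I) (n : ℤ) (r : R) : (α ^ n) r ∈ I ↔ r ∈ I := by
  induction n generalizing r with
  | zero => simp
  | succ n ih =>
    rw [zpow_add_one]
    exact (ih _).trans (h r)
  | pred n ih =>
    rw [zpow_sub_one]
    refine (ih (α.symm r)).trans ((h _).symm.trans ?_)
    rw [α.apply_symm_apply]

theorem mem_specOrbit {α : R ≃+* R} {P Q : PrimeSpectrum R} :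
    Q ∈ specOrbit α P ↔ ∃ n : ℤ, ∀ r, r ∈ Q.asIdeal ↔ (α ^ n) r ∈ P.asIdeal := by
  constructor
  · rintro ⟨n, rfl⟩
    exact ⟨-n, fun r => Iff.rfl⟩
  · rintro ⟨n, hn⟩
    refine ⟨-n, PrimeSpectrum.ext (Ideal.ext fun r => ?_)⟩
    rw [hn r]
    simp only [neg_neg]
    exact Iff.rfl

theorem mem_specOrbit_self (α : R ≃+* R) (P : PrimeSpectrum R) : P ∈ specOrbit α P :=
  mem_specOrbit.mpr ⟨0, fun r => by simp⟩

theorem specOrbit_subset_of_mem {α : R ≃+* R} {P Q : PrimeSpectrum R} (h : Q ∈ specOrbit α P) :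
    specOrbit α Q ⊆ specOrbit α P := by
  intro Q' hQ'
  obtain ⟨n, hn⟩ := mem_specOrbit.mp h
  obtain ⟨m, hm⟩ := mem_specOrbit.mp hQ'
  refine mem_specOrbit.mpr ⟨n + m, fun r => ?_⟩
  rw [hm, hn, zpow_add]
  exact Iff.rfl

theorem mem_specOrbit_comm {α : R ≃+* R} {P Q : PrimeSpectrum R} (h : Q ∈ specOrbit α P) :
    P ∈ specOrbit α Q := by
  obtain ⟨n, hn⟩ := mem_specOrbit.mp h
  refine mem_specOrbit.mpr ⟨-n, fun r => ?_⟩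
  rw [hn, show (α ^ n) ((α ^ (-n)) r) = (α ^ n * α ^ (-n)) r from rfl, ← zpow_add]
  simp

theorem specOrbit_eq_of_mem {α : R ≃+* R} {P Q : PrimeSpectrum R} (h : Q ∈ specOrbit α P) :
    specOrbit α Q = specOrbit α P :=
  (specOrbit_subset_of_mem h).antisymm (specOrbit_subset_of_mem (mem_specOrbit_comm h))

/-- The intersection of a set of primes that is a union of orbits is `α`-invariant. -/
theorem apply_mem_iInf_iff {α : R ≃+* R} {s : Set (PrimeSpectrum R)}
    (hs : ∀ P ∈ s, specOrbit α P ⊆ s) (r : R) :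
    α r ∈ (⨅ P ∈ s, P.asIdeal) ↔ r ∈ (⨅ P ∈ s, P.asIdeal) := by
  simp only [Ideal.mem_iInf]
  constructor
  · intro h P hP
    have h1 := h _ (hs P hP ⟨1, rfl⟩)
    have h2 : (α ^ (-1 : ℤ)) (α r) ∈ P.asIdeal := h1
    rw [zpow_neg_one] at h2
    rwa [show ((α⁻¹ : R ≃+* R)) (α r) = r from α.symm_apply_apply r] at h2
  · intro h P hP
    have h1 := h _ (hs P hP ⟨-1, rfl⟩)
    have h2 : (α ^ (- -1 : ℤ)) r ∈ P.asIdeal := h1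
    rwa [neg_neg, zpow_one] at h2

theorem exists_le_of_iInf_le_of_finite {s : Set (PrimeSpectrum R)} (hs : s.Finite) {P : Ideal R}
    [hP : P.IsPrime] (h : (⨅ Q ∈ s, Q.asIdeal) ≤ P) : ∃ Q ∈ s, Q.asIdeal ≤ P := by
  have h1 : ∏ Q ∈ hs.toFinset, Q.asIdeal ≤ P := by
    refine Ideal.prod_le_inf.trans (le_trans ?_ h)
    exact le_iInf₂ fun Q hQ => Finset.inf_le (hs.mem_toFinset.mpr hQ)
  obtain ⟨Q, hQ, hQP⟩ := (hP.prod_le).mp h1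
  exact ⟨Q, hs.mem_toFinset.mp hQ, hQP⟩

theorem ne_bot_of_mem_specOrbit {α : R ≃+* R} {P Q : PrimeSpectrum R} (h : Q ∈ specOrbit α P)
    (hP : P.asIdeal ≠ ⊥) : Q.asIdeal ≠ ⊥ := by
  obtain ⟨n, hn⟩ := mem_specOrbit.mp (mem_specOrbit_comm h)
  intro h0
  refine hP (eq_bot_iff.mpr fun r hr => ?_)
  rw [hn, h0] at hr
  simpa using hr

/-- The intersection of the nonzero primes with finite orbit. -/
def finiteOrbitIdeal (α : R ≃+* R) : Ideal R :=
  ⨅ P ∈ {P : PrimeSpectrum R | P.asIdeal ≠ ⊥ ∧ (specOrbit α P).Finite}, P.asIdeal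

theorem apply_mem_finiteOrbitIdeal_iff (α : R ≃+* R) (r : R) :
    α r ∈ finiteOrbitIdeal α ↔ r ∈ finiteOrbitIdeal α :=
  apply_mem_iInf_iff (s := {P | P.asIdeal ≠ ⊥ ∧ (specOrbit α P).Finite}) (fun _ hP _ hQ =>
    ⟨ne_bot_of_mem_specOrbit hQ hP.1, hP.2.subset (specOrbit_subset_of_mem hQ)⟩) r

variable [IsDomain R]

theorem iInf_asIdeal_ne_bot_of_finite {s : Set (PrimeSpectrum R)} (hs : s.Finite)
    (h : ∀ P ∈ s, P.asIdeal ≠ ⊥) : (⨅ P ∈ s, P.asIdeal) ≠ ⊥ := by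
  intro h0
  obtain ⟨Q, hQ, hQ0⟩ := exists_le_of_iInf_le_of_finite (P := ⊥) hs h0.le
  exact h Q hQ (le_bot_iff.mp hQ0)

theorem exists_mem_specOrbit_of_isSpecialElement {α : R ≃+* R} {a : R} (ha : IsSpecialElement α a)
    {P : PrimeSpectrum R} (hP : P.asIdeal ≠ ⊥) (hfin : (specOrbit α P).Finite) :
    ∃ Q ∈ specOrbit α P, a ∈ Q.asIdeal := by
  obtain ⟨n, -, -, hn⟩ := ha (⨅ Q ∈ specOrbit α P, Q.asIdeal)
    (iInf_asIdeal_ne_bot_of_finite hfin fun Q hQ => ne_bot_of_mem_specOrbit hQ hP)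
    (Ideal.map_eq_self_of_forall_mem_iff
      (apply_mem_iInf_iff fun Q hQ => specOrbit_subset_of_mem hQ))
  simp only [Ideal.mem_iInf] at hn
  obtain ⟨j, -, hj⟩ := (P.2.prod_mem_iff).mp (hn P (mem_specOrbit_self α P))
  refine ⟨_, ⟨-(j : ℤ), rfl⟩, ?_⟩
  change (α ^ (- -(j : ℤ))) a ∈ P.asIdeal
  rwa [neg_neg, zpow_natCast]

theorem IsSpecialElement.ne_zero {α : R ≃+* R} {a : R} (ha : IsSpecialElement α a) : a ≠ 0 := by
  obtain ⟨n, hn, h0, -⟩ := ha ⊤ top_ne_bot (Ideal.map_eq_self_of_forall_mem_iff (by simp))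
  intro h
  exact h0 (Finset.prod_eq_zero (Finset.mem_range.mpr hn) (by simp [h]))

variable [Ring.KrullDimLE 1 R]

theorem Ideal.IsPrime.mem_minimalPrimes_of_ne_bot {I P : Ideal R} (hP : P.IsPrime) (hI : I ≠ ⊥)
    (h : I ≤ P) : P ∈ I.minimalPrimes := by
  refine ⟨⟨hP, h⟩, fun Q hQ hQP => ?_⟩
  have := hQ.1.isMaximal_of_ne_bot fun h0 => hI (le_bot_iff.mp (h0 ▸ hQ.2))
  exact (this.eq_of_le hP.ne_top hQP).ge

theorem exists_apply_mem_notMem_of_specOrbit_infinite {α : R ≃+* R} {P : PrimeSpectrum R}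
    (h0 : P.asIdeal ≠ ⊥) (hP : ¬ (specOrbit α P).Finite) {j k : ℕ} (hjk : k < j) :
    ∃ t, (α ^ j) t ∈ P.asIdeal ∧ (α ^ k) t ∉ P.asIdeal := by
  by_contra! h
  apply hP
  have hle : P.asIdeal ≤
      (PrimeSpectrum.comap ((α ^ (-((j : ℤ) - k)) : R ≃+* R) : R →+* R) P).asIdeal := by
    intro r hr
    change (α ^ (-((j : ℤ) - k))) r ∈ P.asIdeal
    have h1 := h ((α ^ (-(j : ℤ))) r) (by
      rw [← zpow_natCast, show (α ^ (j : ℤ)) ((α ^ (-(j : ℤ))) r) =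
        (α ^ (j : ℤ) * α ^ (-(j : ℤ))) r from rfl, ← zpow_add]
      simpa using hr)
    rwa [← zpow_natCast, show (α ^ (k : ℤ)) ((α ^ (-(j : ℤ))) r) =
        (α ^ (k : ℤ) * α ^ (-(j : ℤ))) r from rfl, ← zpow_add,
        show (k : ℤ) + -(j : ℤ) = -((j : ℤ) - k) by ring] at h1
  -- Nonzero primes are maximal, so the inclusion is an equality; the orbit is then periodic, hence
  -- finite.
  have heq := PrimeSpectrum.ext ((P.2.isMaximal_of_ne_bot h0).eq_of_le
    (PrimeSpectrum.isPrime _).ne_top hle)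
  have hper : Function.Periodic
      (fun n : ℤ => PrimeSpectrum.comap ((α ^ (-n) : R ≃+* R) : R →+* R) P) ((j : ℤ) - k) := by
    intro n
    conv_rhs => rw [heq]
    refine PrimeSpectrum.ext (Ideal.ext fun r => ?_)
    change (α ^ (-(n + (j - k) : ℤ))) r ∈ P.asIdeal ↔
      (α ^ (-(j - k : ℤ)) * α ^ (-n)) r ∈ P.asIdeal
    rw [← zpow_add, neg_add, add_comm]
  rw [specOrbit, ← hper.image_Ioc (by omega) 0]
  exact (Set.finite_Ioc _ _).image _

variable [IsNoetherianRing R]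

theorem PrimeSpectrum.finite_setOf_le {I : Ideal R} (hI : I ≠ ⊥) :
    {P : PrimeSpectrum R | I ≤ P.asIdeal}.Finite := by
  refine Set.Finite.of_finite_image
    ((Ideal.finite_minimalPrimes_of_isNoetherianRing R I).subset ?_)
    (fun P _ Q _ h => PrimeSpectrum.ext h : Set.InjOn PrimeSpectrum.asIdeal _)
  rintro _ ⟨P, hP, rfl⟩
  exact P.2.mem_minimalPrimes_of_ne_bot hI hP

/-- An `α`-special ring of dimension at most `1` has finitely many finite orbits of primes. -/
theorem finite_finite_specOrbits {α : R ≃+* R} {a : R} (ha : IsSpecialElement α a) :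
    {O : Set (PrimeSpectrum R) | O.Finite ∧ ∃ P, O = specOrbit α P}.Finite := by
  have h1 : {P : PrimeSpectrum R | Ideal.span {a} ≤ P.asIdeal}.Finite :=
    PrimeSpectrum.finite_setOf_le (by simpa using ha.ne_zero)
  refine (((h1.image (specOrbit α)).insert (specOrbit α ⊥))).subset ?_
  rintro _ ⟨hO, P, rfl⟩
  by_cases hP : P.asIdeal = ⊥
  · left
    rw [show P = ⊥ from PrimeSpectrum.ext hP]
  · right
    obtain ⟨Q, hQ, haQ⟩ := exists_mem_specOrbit_of_isSpecialElement ha hP hO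
    exact ⟨Q, by simpa [Ideal.span_singleton_le_iff_mem] using haQ, specOrbit_eq_of_mem hQ⟩

theorem finite_setOf_specOrbit_finite {α : R ≃+* R} {a : R} (ha : IsSpecialElement α a) :
    {P : PrimeSpectrum R | (specOrbit α P).Finite}.Finite := by
  refine ((finite_finite_specOrbits ha).biUnion fun O hO => hO.1).subset fun P hP => ?_
  exact Set.mem_biUnion (show specOrbit α P ∈ _ from ⟨hP, P, rfl⟩) (mem_specOrbit_self α P)

theorem finiteOrbitIdeal_not_le {α : R ≃+* R} {a : R} (ha : IsSpecialElement α a)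
    {P : PrimeSpectrum R} (hP : ¬ (specOrbit α P).Finite) :
    ¬ finiteOrbitIdeal α ≤ P.asIdeal := by
  intro h
  obtain ⟨Q, ⟨hQ0, hQ⟩, hQP⟩ := exists_le_of_iInf_le_of_finite
    ((finite_setOf_specOrbit_finite ha).subset fun _ h => h.2) h
  have := (Q.2.isMaximal_of_ne_bot hQ0).eq_of_le P.2.ne_top hQP
  obtain rfl : Q = P := PrimeSpectrum.ext this
  exact hP hQ

/-- The primes above `I` are finitely many and permuted by `α`, so each of them is nonzero with
finite orbit. -/
theorem finiteOrbitIdeal_le_radical {α : R ≃+* R} {I : Ideal R} (hI : I ≠ ⊥)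
    (hα : I.map (α : R →+* R) = I) : finiteOrbitIdeal α ≤ I.radical := by
  rw [Ideal.radical_eq_sInf]
  refine le_sInf fun J hJ => ?_
  refine iInf₂_le (⟨J, hJ.2⟩ : PrimeSpectrum R) ⟨fun h0 => hI (le_bot_iff.mp (h0 ▸ hJ.1)), ?_⟩
  refine (PrimeSpectrum.finite_setOf_le hI).subset fun Q hQ r hr => ?_
  obtain ⟨n, hn⟩ := mem_specOrbit.mp hQ
  rw [hn]
  exact hJ.1 ((Ideal.zpow_apply_mem_iff (Ideal.forall_mem_iff_of_map_eq_self hα) n r).mpr hr)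

/-- The nonzero elements of `finiteOrbitIdeal α` are `α`-special. -/
theorem isSpecialElement_of_mem_finiteOrbitIdeal {α : R ≃+* R} {a : R} (ha0 : a ≠ 0)
    (ha : a ∈ finiteOrbitIdeal α) : IsSpecialElement α a := by
  intro I hI hα
  obtain ⟨n, hn⟩ := I.exists_radical_pow_le_of_fg (IsNoetherian.noetherian _)
  -- The exponent `n` may be `0`, whereas specialness asks for at least one factor.
  refine ⟨n + 1, by omega, Finset.prod_ne_zero_iff.mpr fun j _ => ?_, hn ?_⟩
  · exact (map_ne_zero_iff _ (α ^ j).injective).mpr ha0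
  · refine Ideal.pow_le_pow_right n.le_succ ?_
    have := Ideal.prod_mem_prod (s := Finset.range (n + 1)) (I := fun _ => I.radical)
      (x := fun j => (α ^ j) a) fun j _ => finiteOrbitIdeal_le_radical hI hα (by
        have := (Ideal.zpow_apply_mem_iff (apply_mem_finiteOrbitIdeal_iff α) j a).mpr ha
        rwa [zpow_natCast] at this)
    simpa using this

end Orbits

/-! ### Countable prime avoidance over an uncountable field -/

/-- Over a ring containing an uncountable field, a finitely generated ideal contained in no member
of a countable family of prime ideals is not contained in its union. -/
theorem Ideal.FG.exists_mem_forall_notMem {R : Type u} [CommRing R] {K : Subring R}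
    (hK : IsField K) [Uncountable K] {ι : Type v} [Countable ι] (P : ι → Ideal R)
    [hP : ∀ i, (P i).IsPrime] {I : Ideal R} (hI : I.FG) (hIP : ∀ i, ¬ I ≤ P i) :
    ∃ a ∈ I, ∀ i, a ∉ P i := by
  have hunit : ∀ t : K, t ≠ 0 → IsUnit (t : R) := fun t ht => by
    obtain ⟨s, hs⟩ := hK.mul_inv_cancel ht
    exact IsUnit.of_mul_eq_one (s : R) (by simpa using congrArg Subtype.val hs)
  -- The conditional form survives induction on generators: a summand of `I` may lie in some `P i`
  -- although `I` does not.
  suffices H : ∃ a ∈ I, ∀ i, ¬ I ≤ P i → a ∉ P i by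
    obtain ⟨a, ha, h⟩ := H
    exact ⟨a, ha, fun i => h i (hIP i)⟩
  clear hIP
  refine Submodule.fg_induction (R := R) (M := R) (motive := fun I _ => ∃ a ∈ I, ∀ i, ¬ I ≤ P i → a ∉ P i) ?_ ?_ I hI
  · exact fun x => ⟨x, Submodule.mem_span_singleton_self x, fun i hi hx =>
      hi ((Submodule.span_singleton_le_iff_mem x _).mpr hx)⟩
  · rintro I J - - ⟨x, hxI, hx⟩ ⟨y, hyJ, hy⟩
    -- Two bad values of `t` differ by a unit, which forces `y`, then `x`, into `P i`. So each prime
    -- excludes at most one `t`.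
    have hsub : ∀ i, {t : K | t ≠ 0 ∧ ¬ I ⊔ J ≤ P i ∧ x + t * y ∈ P i}.Subsingleton := by
      rintro i t ⟨ht, hIJ, hxt⟩ s ⟨hs, -, hxs⟩
      by_contra hts
      have hyP : y ∈ P i := by
        have h1 : ((t - s : K) : R) * y ∈ P i := by
          have := (P i).sub_mem hxt hxs
          push_cast
          convert this using 1
          ring
        exact ((hP i).mem_or_mem h1).resolve_left fun h2 =>
          (hP i).ne_top (Ideal.eq_top_of_isUnit_mem _ h2 (hunit _ (sub_ne_zero.mpr hts)))
      have hxP : x ∈ P i := by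
        simpa using (P i).sub_mem hxt ((P i).mul_mem_left t hyP)
      refine hIJ (sup_le ?_ ?_)
      · by_contra h; exact hx i h hxP
      · by_contra h; exact hy i h hyP
    have hcount : ({0} ∪ ⋃ i, {t : K | t ≠ 0 ∧ ¬ I ⊔ J ≤ P i ∧ x + t * y ∈ P i}).Countable :=
      (Set.countable_singleton _).union (Set.countable_iUnion fun i => (hsub i).countable)
    obtain ⟨t, ht⟩ : ∃ t, t ∉ {0} ∪ ⋃ i, {t : K | t ≠ 0 ∧ ¬ I ⊔ J ≤ P i ∧ x + t * y ∈ P i} := by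
      by_contra! h
      exact Set.not_countable_univ (hcount.mono fun t _ => h t)
    simp only [Set.mem_union, Set.mem_singleton_iff, Set.mem_iUnion, Set.mem_ofPred_eq, not_or,
      not_exists] at ht
    exact ⟨x + t * y, add_mem (Submodule.mem_sup_left hxI)
      (Ideal.mul_mem_left _ _ (Submodule.mem_sup_right hyJ)), fun i hi hmem =>
      ht.2 i ⟨ht.1, hi, hmem⟩⟩

/-! ### Injective hulls of essential extensions -/

section Hull

variable {A : Type u} [Ring A]

/-- Every module embeds into an injective module. -/
theorem Module.exists_injective_embedding (F : Type u) [AddCommGroup F] [Module A F] :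
    ∃ (E : Type u) (_ : AddCommGroup E) (_ : Module A E) (j : F →ₗ[A] E),
      Module.Injective A E ∧ Function.Injective j := by
  obtain ⟨P⟩ := CategoryTheory.EnoughInjectives.presentation (ModuleCat.of A F)
  have hmono := P.mono
  have hinj := P.injective
  exact ⟨P.J, inferInstance, inferInstance, P.f.hom,
    Module.injective_module_of_injective_object A P.J, (ModuleCat.mono_iff_injective P.f).mp hmono⟩

variable {E' : Type u} [AddCommGroup E'] [Module A E']

/-- `V` meets every nonzero submodule of `X`. -/
def Submodule.EssentialIn (V X : Submodule A E') : Prop :=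
  ∀ N ≤ X, N ⊓ V = ⊥ → N = ⊥

/-- An essential extension inside a module is contained in a maximal one. -/
theorem Submodule.EssentialIn.exists_le_maximal {V X : Submodule A E'} (h : V.EssentialIn X) :
    ∃ E, X ≤ E ∧ Maximal V.EssentialIn E := by
  refine zorn_le_nonempty₀ {E | V.EssentialIn E} ?_ X h
  intro c hc hchain Y hY
  refine ⟨sSup c, ?_, fun z hz => le_sSup hz⟩
  intro N hN hNV
  rw [eq_bot_iff]
  intro x hx
  obtain ⟨Z, hZ, hxZ⟩ := (Submodule.mem_sSup_of_directed ⟨Y, hY⟩ hchain.directedOn).mp (hN hx)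
  have hle : Submodule.span A {x} ≤ N := by simpa using hx
  have := hc hZ (Submodule.span A {x}) (by simpa using hxZ)
    (eq_bot_iff.mpr ((inf_le_inf_right V hle).trans hNV.le))
  rw [← this]
  exact Submodule.mem_span_singleton_self x

/-- A maximal essential extension inside an injective module is injective. -/
theorem Submodule.injective_of_maximal_essentialIn [hE' : Module.Injective A E']
    {V E : Submodule A E'} (hE : Maximal V.EssentialIn E) : Module.Injective A E := by
  obtain ⟨C, hC⟩ : ∃ C, Maximal (fun C : Submodule A E' => Disjoint E C) C := by
    refine zorn_le₀ {C : Submodule A E' | Disjoint E C} ?_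
    intro c hc hchain
    refine ⟨sSup c, ?_, fun z hz => le_sSup hz⟩
    exact hchain.directedOn.disjoint_sSup_right.mpr fun b hb => hc hb
  have hmax : ∀ D : Submodule A E', Disjoint E D → C ≤ D → D = C := fun D hD hCD =>
    le_antisymm (hC.2 hD hCD) hCD
  have hf : Function.Injective (C.mkQ ∘ₗ E.subtype) := by
    rw [← LinearMap.ker_eq_bot, LinearMap.ker_eq_bot']
    intro x hx
    have hxC : (x : E') ∈ C := by simpa using hx
    simpa using (Submodule.disjoint_def.mp hC.1) x x.2 hxC
  obtain ⟨g, hg⟩ := hE'.out (C.mkQ ∘ₗ E.subtype) hf E.subtype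
  have hg' : ∀ x ∈ E, g (C.mkQ x) = x := fun x hx => hg ⟨x, hx⟩
  -- `ρ` fixes `E` and kills its maximal complement `C`. Its range is still essential over `V`, so
  -- maximality makes `ρ` a retraction onto `E`.
  set ρ : E' →ₗ[A] E' := g ∘ₗ C.mkQ with hρ
  have hEρ : E ≤ LinearMap.range ρ := fun x hx => ⟨x, hg' x hx⟩
  have hCρ : ∀ N : Submodule A E', C ≤ N.comap ρ := fun N x hx => by
    have : C.mkQ x = 0 := by simpa using hx
    simp [hρ, this]
  have hess : V.EssentialIn (LinearMap.range ρ) := by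
    intro N hN hNV
    have h1 : N ⊓ E = ⊥ := hE.1 _ inf_le_right (by
      rw [eq_bot_iff, ← hNV]
      exact inf_le_inf_right _ inf_le_left)
    have h2 : N.comap ρ = C := by
      refine hmax _ (Submodule.disjoint_def.mpr fun x hxE hxN => ?_) (hCρ N)
      have : x ∈ N := by
        have h3 : ρ x ∈ N := hxN
        rwa [show ρ x = x from hg' x hxE] at h3
      exact (Submodule.mem_bot A).mp (h1 ▸ ⟨this, hxE⟩)
    rw [eq_bot_iff]
    intro y hy
    obtain ⟨x, rfl⟩ := hN hy
    have hxC : x ∈ C := by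
      rw [← h2]
      exact hy
    have := hCρ ⊥ hxC
    simpa using this
  have hrange : ∀ x, ρ x ∈ E := fun x => hE.2 hess hEρ ⟨x, rfl⟩
  refine ⟨fun X Y _ _ _ _ f hf φ => ?_⟩
  obtain ⟨h, hh⟩ := hE'.out f hf (E.subtype ∘ₗ φ)
  refine ⟨(ρ ∘ₗ h).codRestrict E fun y => hrange _, fun x => Subtype.ext ?_⟩
  have := hh x
  simp only [LinearMap.comp_apply, Submodule.subtype_apply] at this
  simp only [LinearMap.codRestrict_apply, LinearMap.comp_apply, this]
  exact hg' _ (φ x).2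

/-- If `V` is essential in `F`, then some injective hull of `V` contains `F`. -/
theorem exists_isInjectiveHull_of_essential {F : Type u} [AddCommGroup F] [Module A F]
    (V : Submodule A F) (hV : ∀ N : Submodule A F, N ⊓ V = ⊥ → N = ⊥) :
    ∃ (E : Type u) (_ : AddCommGroup E) (_ : Module A E) (j : F →ₗ[A] E),
      Function.Injective j ∧ IsInjectiveHull A (j ∘ₗ V.subtype) := by
  obtain ⟨E', _, _, j, hE', hj⟩ := Module.exists_injective_embedding (A := A) F
  have h0 : (V.map j).EssentialIn (LinearMap.range j) := by
    intro N hN hNV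
    have h1 : N.comap j = ⊥ := by
      refine hV _ (eq_bot_iff.mpr fun x hx => ?_)
      have : j x ∈ N ⊓ V.map j := ⟨hx.1, Submodule.mem_map_of_mem hx.2⟩
      rw [hNV, Submodule.mem_bot] at this
      exact (Submodule.mem_bot A).mpr ((map_eq_zero_iff j hj).mp this)
    rw [← Submodule.map_comap_eq_of_le hN, h1, Submodule.map_bot]
  obtain ⟨E, hjE, hmax⟩ := h0.exists_le_maximal
  refine ⟨E, inferInstance, inferInstance, j.codRestrict E fun x => hjE ⟨x, rfl⟩, ?_, ?_, ?_, ?_⟩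
  · exact fun x y hxy => hj (congrArg Subtype.val hxy)
  · exact Submodule.injective_of_maximal_essentialIn hmax
  · exact fun x y hxy => Subtype.ext (hj (congrArg Subtype.val hxy))
  · intro N hN
    have : N.map E.subtype = ⊥ := by
      refine hmax.1 _ (Submodule.map_subtype_le E N) (eq_bot_iff.mpr ?_)
      rintro _ ⟨⟨x, hxN, rfl⟩, y, hyV, hy⟩
      have hx : x ∈ N ⊓ LinearMap.range
          ((j.codRestrict E fun x => hjE ⟨x, rfl⟩) ∘ₗ V.subtype) :=
        ⟨hxN, ⟨y, hyV⟩, Subtype.ext hy⟩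
      rw [hN, Submodule.mem_bot] at hx
      simp [hx]
    exact Submodule.map_injective_of_injective E.subtype_injective (by rw [this, Submodule.map_bot])

end Hull

/-! ### Twisting the fraction field into a right module over the skew polynomial ring -/

section Twisted

variable {R : Type u} [CommRing R]

/-- The fraction field of `R`, as a right module over `R[θ; α]` on which `θ` acts by
`x ↦ a⁻¹ α⁻¹(x)`. -/
def TwistedFractionRing (_α : R ≃+* R) (_a : R) : Type u := FractionRing R

namespace TwistedFractionRing

variable [IsDomain R] (α : R ≃+* R) (a : R)

noncomputable instance : Field (TwistedFractionRing α a) :=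
  inferInstanceAs (Field (FractionRing R))

noncomputable instance : Algebra R (TwistedFractionRing α a) :=
  inferInstanceAs (Algebra R (FractionRing R))

instance : IsFractionRing R (TwistedFractionRing α a) :=
  inferInstanceAs (IsFractionRing R (FractionRing R))

/-- The action `x ↦ a⁻¹ α⁻¹(x)` of `θ`. -/
noncomputable def twist : AddMonoid.End (TwistedFractionRing α a) :=
  (AddMonoidHom.mulLeft (algebraMap R (TwistedFractionRing α a) a)⁻¹).comp
    (IsFractionRing.ringEquivOfRingEquiv α.symm :
      TwistedFractionRing α a ≃+* TwistedFractionRing α a).toAddMonoidHom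

variable {α a}

theorem twist_apply (x : TwistedFractionRing α a) :
    twist α a x = (algebraMap R _ a)⁻¹ * IsFractionRing.ringEquivOfRingEquiv α.symm x := rfl

/-- This is the relation `θ r = α(r) θ`, read as acting on the right. -/
theorem twist_mul (r : R) (x : TwistedFractionRing α a) :
    twist α a (algebraMap R _ (α r) * x) = algebraMap R _ r * twist α a x := by
  rw [twist_apply, twist_apply, map_mul, IsFractionRing.ringEquivOfRingEquiv_algebraMap,
    α.symm_apply_apply]
  ring

theorem twist_pow_mul (n : ℕ) (r : R) (x : TwistedFractionRing α a) :
    (twist α a ^ n) (algebraMap R _ ((α ^ n) r) * x) = algebraMap R _ r * (twist α a ^ n) x := by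
  induction n generalizing x with
  | zero => simp
  | succ n ih =>
    rw [pow_succ, pow_succ']
    change (twist α a ^ n) (twist α a (algebraMap R _ (α ((α ^ n) r)) * x)) = _
    rw [twist_mul, ih]
    rfl

variable (α a)

/-- The action of `R[θ; α]` on the right of the twisted fraction field. -/
noncomputable def toEnd :
    SkewPolynomialRing R α →+* (AddMonoid.End (TwistedFractionRing α a))ᵐᵒᵖ :=
  letI : MulSemiringAction (Multiplicative ℕ) R := autPowAction α
  SkewMonoidAlgebra.liftNCRingHom
    { toFun := fun r => MulOpposite.op (AddMonoidHom.mulLeft (algebraMap R _ r))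
      map_one' := MulOpposite.unop_injective (AddMonoidHom.ext fun x => by
        change algebraMap R _ 1 * x = x
        rw [map_one, one_mul])
      map_zero' := MulOpposite.unop_injective (AddMonoidHom.ext fun x => by
        change algebraMap R _ 0 * x = 0
        rw [map_zero, zero_mul])
      map_mul' := fun r s => MulOpposite.unop_injective (AddMonoidHom.ext fun x => by
        change algebraMap R _ (r * s) * x = algebraMap R _ s * (algebraMap R _ r * x)
        rw [map_mul]
        ring)
      map_add' := fun r s => MulOpposite.unop_injective (AddMonoidHom.ext fun x => by
        change algebraMap R _ (r + s) * x = algebraMap R _ r * x + algebraMap R _ s * x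
        rw [map_add, add_mul]) }
    (powersHom _ (MulOpposite.op (twist α a)))
    (fun {r n} => MulOpposite.unop_injective (AddMonoidHom.ext fun x =>
      twist_pow_mul (Multiplicative.toAdd n) r x))

noncomputable instance : Module (SkewPolynomialRing R α)ᵐᵒᵖ (TwistedFractionRing α a) :=
  Module.compHom (R := AddMonoid.End (TwistedFractionRing α a)) _
    ((RingEquiv.opOp (AddMonoid.End (TwistedFractionRing α a))).symm.toRingHom.comp
      (RingHom.op (toEnd α a)))

/-- The monomial `r θⁿ`. -/
noncomputable def monomial (n : ℕ) (r : R) : SkewPolynomialRing R α :=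
  SkewMonoidAlgebra.single (Multiplicative.ofAdd n) r

variable {α a}

theorem op_monomial_smul (n : ℕ) (r : R) (x : TwistedFractionRing α a) :
    MulOpposite.op (monomial α n r) • x = (twist α a ^ n) (algebraMap R _ r * x) := by
  change (MulOpposite.unop (toEnd α a (monomial α n r))) x = _
  let : MulSemiringAction (Multiplicative ℕ) R := autPowAction α
  have : toEnd α a (monomial α n r) = _ := SkewMonoidAlgebra.liftNC_single _ _ _ _
  rw [this]
  rfl

theorem smul_mem_of_forall_monomial (L : AddSubgroup (TwistedFractionRing α a))
    {x : TwistedFractionRing α a}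
    (h : ∀ (n : ℕ) (r : R), (twist α a ^ n) (algebraMap R _ r * x) ∈ L)
    (s : (SkewPolynomialRing R α)ᵐᵒᵖ) : s • x ∈ L := by
  induction s using MulOpposite.rec' with
  | h s =>
  refine SkewMonoidAlgebra.induction_on
    (p := fun s => MulOpposite.op (show SkewPolynomialRing R α from s) • x ∈ L) s ?_ ?_ ?_
  · change (0 : (SkewPolynomialRing R α)ᵐᵒᵖ) • x ∈ L
    rw [zero_smul]
    exact L.zero_mem
  · intro n r
    have := h (Multiplicative.toAdd n) r
    rwa [← op_monomial_smul] at this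
  · intro f g hf hg
    change (MulOpposite.op (show SkewPolynomialRing R α from f) +
      MulOpposite.op (show SkewPolynomialRing R α from g)) • x ∈ L
    rw [add_smul]
    exact L.add_mem hf hg

variable {W : Submodule (SkewPolynomialRing R α)ᵐᵒᵖ (TwistedFractionRing α a)}

theorem twist_pow_mem {x : TwistedFractionRing α a} (hx : x ∈ W) (n : ℕ) :
    (twist α a ^ n) x ∈ W := by
  simpa [op_monomial_smul] using W.smul_mem (MulOpposite.op (monomial α n 1)) hx

theorem algebraMap_mul_mem {x : TwistedFractionRing α a} (hx : x ∈ W) (r : R) :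
    algebraMap R _ r * x ∈ W := by
  simpa [op_monomial_smul] using W.smul_mem (MulOpposite.op (monomial α 0 r)) hx

theorem mul_twist (ha : a ≠ 0) (r : R) :
    algebraMap R (TwistedFractionRing α a) a * twist α a (algebraMap R _ r) =
      algebraMap R _ (α.symm r) := by
  have : algebraMap R (TwistedFractionRing α a) a ≠ 0 := by simpa using ha
  rw [twist_apply, IsFractionRing.ringEquivOfRingEquiv_algebraMap, mul_inv_cancel_left₀ this]

/-- Each application of `θ` shifts the product back by `α⁻¹` and cancels the factor `a` that
appears. -/
theorem twist_pow_algebraMap_prod (ha : a ≠ 0) (n : ℕ) :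
    (twist α a ^ n) (algebraMap R _ (α (∏ j ∈ Finset.range n, (α ^ j) a))) = 1 := by
  induction n with
  | zero => simp
  | succ n ih =>
    have ha' : algebraMap R (TwistedFractionRing α a) a ≠ 0 := by simpa using ha
    rw [pow_succ]
    change (twist α a ^ n) (twist α a _) = 1
    rw [← ih]
    congr 1
    apply mul_left_cancel₀ ha'
    rw [mul_twist ha, ← map_mul, Finset.prod_range_succ', α.symm_apply_apply, map_prod, mul_comm]
    congr 2
    refine Finset.prod_congr rfl fun j _ => ?_
    rw [pow_succ']
    rfl

variable [IsNoetherianRing R]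

/-- If `a` is `α`-special, then every nonzero submodule contains `1`. -/
theorem one_mem_of_ne_bot (ha0 : a ≠ 0) (ha : IsSpecialElement α a) (hW : W ≠ ⊥) : 1 ∈ W := by
  let I : Ideal R :=
    { carrier := {r | algebraMap R (TwistedFractionRing α a) r ∈ W}
      add_mem' := fun {r s} hr hs => by
        simpa using W.add_mem hr hs
      zero_mem' := by simp
      smul_mem' := fun r s hs => by
        simpa using algebraMap_mul_mem hs r }
  have hmem : ∀ r, r ∈ I ↔ algebraMap R (TwistedFractionRing α a) r ∈ W := fun r => Iff.rfl
  have hI : I ≠ ⊥ := by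
    obtain ⟨x, hx, hx0⟩ := W.ne_bot_iff.mp hW
    obtain ⟨r, s, hs, rfl⟩ := IsFractionRing.div_surjective R x
    have hs0 : algebraMap R (TwistedFractionRing α a) s ≠ 0 := by
      simpa using nonZeroDivisors.ne_zero hs
    have hr : r ∈ I := by
      rw [hmem]
      simpa [mul_div_cancel₀, hs0] using algebraMap_mul_mem hx s
    intro h0
    rw [h0, Ideal.mem_bot] at hr
    simp [hr] at hx0
  have hsymm : ∀ r ∈ I, α.symm r ∈ I := fun r hr => by
    rw [hmem, ← mul_twist ha0]
    exact algebraMap_mul_mem (by simpa using twist_pow_mem hr 1) a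
  have hle : I ≤ I.map (α : R →+* R) := fun r hr => by
    simpa using Ideal.mem_map_of_mem (α : R →+* R) (hsymm r hr)
  -- The chain `I ≤ α(I) ≤ α²(I) ≤ ⋯` stabilizes, and injectivity of `J ↦ α(J)` brings the equality
  -- back to the first step.
  have hmap : I.map (α : R →+* R) = I := by
    let f : ℕ →o Ideal R := ⟨fun n => (Ideal.map (α : R →+* R))^[n] I,
      monotone_nat_of_le_succ fun n => by
        rw [Function.iterate_succ_apply]
        exact (Monotone.iterate (fun _ _ h => Ideal.map_mono h) n) hle⟩
    obtain ⟨n, hn⟩ := monotone_stabilizes_iff_noetherian.mpr ‹IsNoetherianRing R› f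
    have hinj : Function.Injective (Ideal.map (α : R →+* R)) := fun J K h => by
      have h1 := congrArg (Ideal.comap (α : R →+* R)) h
      rwa [Ideal.comap_map_of_bijective (α : R →+* R) α.bijective,
        Ideal.comap_map_of_bijective (α : R →+* R) α.bijective] at h1
    have h1 := hn (n + 1) n.le_succ
    change (Ideal.map (α : R →+* R))^[n] I = (Ideal.map (α : R →+* R))^[n + 1] I at h1
    rw [Function.iterate_succ_apply] at h1
    exact (hinj.iterate n h1).symm
  obtain ⟨n, -, -, hn⟩ := ha I hI hmap
  have h1 : α (∏ j ∈ Finset.range n, (α ^ j) a) ∈ I := by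
    rw [← hmap]
    exact Ideal.mem_map_of_mem (α : R →+* R) hn
  rw [← twist_pow_algebraMap_prod (α := α) ha0 n]
  exact twist_pow_mem h1 n

end TwistedFractionRing

end Twisted

/-! ### Failure of (⋄) -/

/-- For a height one prime `P` of a noetherian domain with fraction field `F`, some `m : F` has
`P` as its annihilator modulo `R`. -/
theorem exists_forall_mul_mem_range_iff_mem {R : Type u} [CommRing R] [IsDomain R]
    [IsNoetherianRing R] [Ring.KrullDimLE 1 R] (F : Type v) [Field F] [Algebra R F]
    [IsFractionRing R F] {P : Ideal R} (hP : P.IsPrime) (h0 : P ≠ ⊥) :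
    ∃ m : F, ∀ r, (∃ c, algebraMap R F r * m = algebraMap R F c) ↔ r ∈ P := by
  obtain ⟨x, hx, hx0⟩ := P.ne_bot_iff.mp h0
  -- `P` is minimal over `(x)`, hence an associated prime of `R/(x)`: `P = ((x) : y)`, and `m = y/x`
  -- works.
  have hmin : P ∈ ((Ideal.span {x} : Ideal R).colon {1}).minimalPrimes := by
    have : (Ideal.span {x} : Ideal R).colon {1} = Ideal.span {x} := by
      ext r
      simp [Submodule.mem_colon_singleton]
    rw [this]
    exact hP.mem_minimalPrimes_of_ne_bot (by simpa using hx0)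
      ((Ideal.span_singleton_le_iff_mem _).mpr hx)
  obtain ⟨y, hy⟩ := Submodule.exists_eq_colon_of_mem_minimalPrimes hmin
  have hx' : algebraMap R F x ≠ 0 := by simpa using hx0
  refine ⟨algebraMap R F y / algebraMap R F x, fun r => ?_⟩
  rw [hy, Submodule.mem_colon_singleton, smul_eq_mul, Ideal.mem_span_singleton]
  refine exists_congr fun c => ?_
  rw [← mul_div_assoc, div_eq_iff hx', ← map_mul, ← map_mul,
    (IsFractionRing.injective R F).eq_iff, mul_comm x c]

namespace TwistedFractionRing

variable {R : Type u} [CommRing R] [IsDomain R] {α : R ≃+* R} {a : R}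

theorem exists_eq_algebraMap_of_twist_pow (ha : a ≠ 0) (n : ℕ) {x : TwistedFractionRing α a}
    {c : R} (h : (twist α a ^ n) x = algebraMap R _ c) : ∃ e, x = algebraMap R _ e := by
  have ha' : algebraMap R (TwistedFractionRing α a) a ≠ 0 := by simpa using ha
  induction n generalizing c with
  | zero => exact ⟨c, h⟩
  | succ n ih =>
    rw [pow_succ'] at h
    replace h : twist α a ((twist α a ^ n) x) = algebraMap R _ c := h
    refine ih (c := α (a * c)) ?_
    rw [twist_apply, inv_mul_eq_iff_eq_mul₀ ha', ← map_mul] at h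
    apply (IsFractionRing.ringEquivOfRingEquiv α.symm :
      TwistedFractionRing α a ≃+* TwistedFractionRing α a).injective
    rw [h, IsFractionRing.ringEquivOfRingEquiv_algebraMap, α.symm_apply_apply]

/-- The denominator introduced by `θⁿ` is a product of `α`-translates of `a`, so it avoids the whole
orbit of `P`. -/
theorem exists_mul_twist_pow_eq_algebraMap (ha : a ≠ 0) {P : Ideal R} [hP : P.IsPrime]
    (haP : ∀ i : ℤ, (α ^ i) a ∉ P) (n : ℕ) :
    ∃ d, (∀ i : ℤ, (α ^ i) d ∉ P) ∧ ∀ c, ∃ e,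
      algebraMap R (TwistedFractionRing α a) d * (twist α a ^ n) (algebraMap R _ c) =
        algebraMap R _ e := by
  induction n with
  | zero => exact ⟨1, fun i => by simpa using hP.one_notMem, fun c => ⟨c, by simp⟩⟩
  | succ n ih =>
    obtain ⟨d, hd, hde⟩ := ih
    refine ⟨a * α.symm d, fun i h => ?_, fun c => ?_⟩
    · rw [map_mul] at h
      refine (hP.mem_or_mem h).elim (haP i) fun h' => hd (i - 1) ?_
      rwa [zpow_sub_one]
    · obtain ⟨e, he⟩ := hde c
      refine ⟨α.symm e, ?_⟩
      rw [pow_succ', ← mul_twist ha, ← he, map_mul, mul_assoc]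
      congr 1
      change _ * twist α a ((twist α a ^ n) _) = _
      rw [← twist_mul, α.apply_symm_apply]

/-- The elements of the fraction field that are integral at the prime `α⁻ᵏ(P)`. -/
def localSubgroup (α : R ≃+* R) (a : R) (P : Ideal R) [hP : P.IsPrime] (k : ℕ) :
    AddSubgroup (TwistedFractionRing α a) where
  carrier := {x | ∃ s, (α ^ k) s ∉ P ∧ ∃ c, algebraMap R _ s * x = algebraMap R _ c}
  zero_mem' := ⟨1, by simpa using hP.one_notMem, 0, by simp⟩
  add_mem' := by
    rintro x y ⟨s, hs, c, hc⟩ ⟨t, ht, d, hd⟩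
    refine ⟨s * t, ?_, t * c + s * d, ?_⟩
    · rw [map_mul]
      exact fun h => (hP.mem_or_mem h).elim hs ht
    · simp only [map_add, map_mul, ← hc, ← hd]
      ring
  neg_mem' := by
    rintro x ⟨s, hs, c, hc⟩
    exact ⟨s, hs, -c, by rw [mul_neg, hc, map_neg]⟩

theorem not_isFiniteLength_span_singleton (ha : a ≠ 0) {P : Ideal R} [hP : P.IsPrime]
    (haP : ∀ i : ℤ, (α ^ i) a ∉ P)
    (hinf : ∀ j k : ℕ, k < j → ∃ t, (α ^ j) t ∈ P ∧ (α ^ k) t ∉ P)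
    {m : TwistedFractionRing α a}
    (hm : ∀ r, (∃ c, algebraMap R _ r * m = algebraMap R _ c) ↔ r ∈ P) :
    ¬ IsFiniteLength (SkewPolynomialRing R α)ᵐᵒᵖ
      (Submodule.span (SkewPolynomialRing R α)ᵐᵒᵖ {m}) := by
  intro hfin
  let N : ℕ → Submodule (SkewPolynomialRing R α)ᵐᵒᵖ (TwistedFractionRing α a) := fun k =>
    Submodule.span _ {(twist α a ^ k) m}
  have hanti : Antitone N := antitone_nat_of_succ_le fun k => by
    refine (Submodule.span_singleton_le_iff_mem _ _).mpr ?_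
    rw [pow_succ']
    exact twist_pow_mem (Submodule.mem_span_singleton_self ((twist α a ^ k) m)) 1
  have hart := (isFiniteLength_iff_isNoetherian_isArtinian.mp hfin).2
  obtain ⟨k, hk⟩ := IsArtinian.monotone_stabilizes
    (M := Submodule.span (SkewPolynomialRing R α)ᵐᵒᵖ {m})
    ⟨fun k => OrderDual.toDual ((N k).comap (Submodule.subtype _)),
      fun i j hij => Submodule.comap_mono (hanti hij)⟩
  have hmem : (twist α a ^ k) m ∈ N (k + 1) := by
    have h1 : (N k).comap (Submodule.subtype (Submodule.span _ {m})) =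
      (N (k + 1)).comap (Submodule.subtype _) := hk (k + 1) k.le_succ
    have h2 : (⟨_, twist_pow_mem (Submodule.mem_span_singleton_self m) k⟩ :
        Submodule.span (SkewPolynomialRing R α)ᵐᵒᵖ {m}) ∈
        (N k).comap (Submodule.subtype (Submodule.span _ {m})) :=
      Submodule.mem_span_singleton_self _
    rwa [h1] at h2
  obtain ⟨s, hs⟩ := Submodule.mem_span_singleton.mp hmem
  -- Everything generated by `θᵏ⁺¹ m` is integral at `α⁻ᵏ(P)`: `t` clears the pole at
  -- `α⁻⁽ⁿ⁺ᵏ⁺¹⁾(P)`, `d` the powers of `a⁻¹`, and neither vanishes at `α⁻ᵏ(P)`.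
  have hL : (twist α a ^ k) m ∈ localSubgroup α a P k := by
    rw [← hs]
    refine smul_mem_of_forall_monomial _ (fun n r => ?_) s
    obtain ⟨t, htP, htk⟩ := hinf (n + (k + 1)) k (by omega)
    obtain ⟨c, hc⟩ := (hm _).mpr htP
    obtain ⟨d, hd, hde⟩ := exists_mul_twist_pow_eq_algebraMap ha haP (n + (k + 1))
    obtain ⟨e, he⟩ := hde ((α ^ (k + 1)) r * c)
    refine ⟨d * t, ?_, e, ?_⟩
    · rw [map_mul]
      refine fun h => (hP.mem_or_mem h).elim (fun h' => hd k ?_) htk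
      rwa [zpow_natCast]
    · rw [← he, map_mul, mul_assoc]
      congr 1
      rw [← twist_pow_mul (k + 1) r m]
      change _ * (twist α a ^ n * twist α a ^ (k + 1)) _ = _
      rw [← pow_add, ← twist_pow_mul, RingHom.map_mul, ← hc]
      congr 1
      ring
  -- Yet `s θᵏ(m) = θᵏ(αᵏ(s) m)` in `R` gives `αᵏ(s) m ∈ R`, that is `αᵏ(s) ∈ P`.
  obtain ⟨s, hs, c, hc⟩ := hL
  rw [← twist_pow_mul] at hc
  exact hs ((hm _).mp (exists_eq_algebraMap_of_twist_pow ha k hc))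

theorem not_satisfiesDiamond [IsNoetherianRing R] [Ring.KrullDimLE 1 R]
    (ha0 : a ≠ 0) (ha : IsSpecialElement α a) {P : PrimeSpectrum R} (hP0 : P.asIdeal ≠ ⊥)
    (hP : ¬ (specOrbit α P).Finite) (haP : ∀ i : ℤ, (α ^ i) a ∉ P.asIdeal) :
    ¬ SatisfiesDiamond (SkewPolynomialRing R α) := by
  intro hS
  let V := Submodule.span (SkewPolynomialRing R α)ᵐᵒᵖ {(1 : TwistedFractionRing α a)}
  have hV : ∀ W : Submodule (SkewPolynomialRing R α)ᵐᵒᵖ (TwistedFractionRing α a),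
      W ≠ ⊥ → V ≤ W := fun W hW =>
    (Submodule.span_singleton_le_iff_mem _ _).mpr (one_mem_of_ne_bot ha0 ha hW)
  have hV0 : V ≠ ⊥ := by simp [V]
  have hsimple : IsSimpleModule (SkewPolynomialRing R α)ᵐᵒᵖ V := by
    refine isSimpleModule_iff_isAtom.mpr ⟨hV0, fun W hW => ?_⟩
    by_contra h
    exact hW.not_ge (hV W h)
  obtain ⟨E, _, _, j, hj, hE⟩ := exists_isInjectiveHull_of_essential V fun W hW => by
    by_contra h
    rw [inf_eq_right.mpr (hV W h)] at hW
    exact hV0 hW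
  obtain ⟨m, hm⟩ := exists_forall_mul_mem_range_iff_mem (TwistedFractionRing α a) P.2 hP0
  have hfin := hS V hsimple E _ hE _ ((Submodule.fg_span_singleton m).map j)
  exact not_isFiniteLength_span_singleton ha0 haP
    (fun _ _ h => exists_apply_mem_notMem_of_specOrbit_infinite hP0 hP h) hm
    ((Submodule.equivMapOfInjective j hj _).symm.isFiniteLength hfin)

end TwistedFractionRing

theorem finite_specOrbit_of_eq_bot {R : Type u} [CommRing R] {α : R ≃+* R} {P : PrimeSpectrum R}
    (h : P.asIdeal = ⊥) : (specOrbit α P).Finite := by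
  refine (Set.finite_singleton P).subset fun Q hQ => ?_
  by_contra hne
  obtain ⟨n, hn⟩ := mem_specOrbit.mp hQ
  refine hne (PrimeSpectrum.ext (Ideal.ext fun r => ?_))
  rw [hn, h, Ideal.mem_bot, Ideal.mem_bot]
  exact map_eq_zero_iff _ (α ^ n).injective

theorem proposition3p2 {R : Type u} [CommRing R] [IsDomain R] [IsNoetherianRing R]
    (hdim : ringKrullDim R = 1) (α : R ≃+* R) (hα : IsSpecialRing R α) :
    ({O : Set (PrimeSpectrum R) | O.Finite ∧ ∃ P, O = specOrbit α P}.Finite ∧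
      ((∀ P : PrimeSpectrum R, (specOrbit α P).Finite) → Finite (PrimeSpectrum R))) ∧
    ((∃ K : Subring R, IsField K ∧ Uncountable K) → Infinite (PrimeSpectrum R) →
      ¬ SatisfiesDiamond (SkewPolynomialRing R α)) := by
  obtain ⟨a₀, ha₀⟩ := hα
  have : Ring.KrullDimLE 1 R := (Order.krullDimLE_iff 1 (PrimeSpectrum R)).mpr hdim.le
  have hfin : (∀ P : PrimeSpectrum R, (specOrbit α P).Finite) → Finite (PrimeSpectrum R) :=
    fun h => Set.finite_univ_iff.mp
      ((finite_setOf_specOrbit_finite ha₀).subset fun P _ => h P)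
  refine ⟨⟨finite_finite_specOrbits ha₀, hfin⟩, ?_⟩
  rintro ⟨K, hK, hKunc⟩ hinf
  obtain ⟨P, hP⟩ : ∃ P : PrimeSpectrum R, ¬ (specOrbit α P).Finite := by
    by_contra! h
    exact not_finite_iff_infinite.mpr hinf (hfin fun P => Set.not_infinite.mp fun h' => h' (h P))
  have hP0 : P.asIdeal ≠ ⊥ := fun h => hP (finite_specOrbit_of_eq_bot h)
  obtain ⟨a, haI, haP⟩ := Ideal.FG.exists_mem_forall_notMem hK
    (fun n : ℤ => (PrimeSpectrum.comap ((α ^ (-n) : R ≃+* R) : R →+* R) P).asIdeal)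
    (IsNoetherian.noetherian (finiteOrbitIdeal α)) fun n =>
      finiteOrbitIdeal_not_le ha₀ fun h => hP (by
        rwa [specOrbit_eq_of_mem (P := P) ⟨n, rfl⟩] at h)
  have ha0 : a ≠ 0 := fun h => haP 0 (h ▸ Ideal.zero_mem _)
  refine TwistedFractionRing.not_satisfiesDiamond ha0
    (isSpecialElement_of_mem_finiteOrbitIdeal ha0 haI) hP0 hP fun i hi => haP (-i) ?_
  change (α ^ (- -i)) a ∈ P.asIdeal
  rwa [neg_neg]
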